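/- Let $G=(N,E,w)$ be a finite connected simple graph with edge-weights $w:E\to\mathbb{R}$. For $A\subseteq N$ let $E(A)$ be the set of edges with both ends in $A$, let $\Sigma(A)\subseteq E(A)$ be the set of edges of minimum weight in $E(A)$, and let $\mathcal{P}_{\min}(A)$ be the partition of $A$ into the vertex sets of the connected components of the graph $(A,E(A)\setminus\Sigma(A))$. A (zero-normalized) game is a function $v:2^N\to\mathbb{R}$ with $v(\emptyset)=0$ and $v(\{i\})=0$ for all $i\in N$; a function $v:2^N\to\mathbb{R}$ is convex if $v(A\cup B)+v(A\cap B)\ge v(A)+v(B)$ for all $A,B\subseteq N$. The $\mathcal{P}_{\min}$-restricted game of $v$ is $\overline{v}(A)=\sum_{F\in\mathcal{P}_{\min}(A)}v(F)$. There is inheritance of convexity for $\mathcal{P}_{\min}$ if $\overline{v}$ is convex for every convex game $v$. Assume that the edge-weights take exactly two different values $\sigma_1<\sigma_2$, and that exactly one edge, $e_1=\{1,2\}$, has weight $\sigma_1$. Then there is inheritance of convexity for $\mathcal{P}_{\min}$ if and only if both of the following conditions hold (a cycle is a simple cycle of length at least $3$): 1. There exists at most one chordless (that is, induced) cycle containing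 the edge $e_1$. 2. For every cycle $C$ all of whose edges have weight $\sigma_2$, either $C$ is complete (any two distinct vertices of $C$ are adjacent in $G$) or all vertices of $C$ are linked to the same end-vertex of $e_1$ (for some $z\in\{1,2\}$, every vertex of $C$ other than $z$ is adjacent to $z$ in $G$). The two alternatives need not exclude each other. -/

import Mathlib

namespace PminGame

variable {V : Type*}

/-- The set of edges `E(A)` of the subgraph of `G` induced by `A`. -/
def inducedEdges (G : SimpleGraph V) (A : Finset V) : Set (Sym2 V) :=
  {e | e ∈ G.edgeSet ∧ ∀ x ∈ e, x ∈ A}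

/-- The set `Σ(A)` of minimum weight edges of the subgraph of `G` induced by `A`.
The weight function `w` is only ever evaluated at edges of `G`. -/
def minEdges (G : SimpleGraph V) (w : Sym2 V → ℝ) (A : Finset V) : Set (Sym2 V) :=
  {e | e ∈ inducedEdges G A ∧ ∀ e' ∈ inducedEdges G A, w e ≤ w e'}

/-- The graph with edge set `E(A) \ Σ(A)`. It is a graph on all of `V`, but its edges have both
ends in `A`, so that the vertices outside `A` are isolated. -/
def pminGraph (G : SimpleGraph V) (w : Sym2 V → ℝ) (A : Finset V) : SimpleGraph V :=
  SimpleGraph.fromEdgeSet (inducedEdges G A \ minEdges G w A)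

open Classical in
/-- The partition `P_min(A)` of `A` into the vertex sets of the connected components of
`(A, E(A) \ Σ(A))`. (For `A = ∅` there are no blocks; for a game this gives the same restricted
worth, `0`, as the convention of a single empty block.) -/
noncomputable def pmin (G : SimpleGraph V) (w : Sym2 V → ℝ) (A : Finset V) : Finset (Finset V) :=
  A.image fun x => A.filter fun y => (pminGraph G w A).Reachable x y

/-- The characteristic function of the `P_min`-restricted game:
the sum of the worths of the blocks of `P_min(A)`. -/
noncomputable def restrictedGame (G : SimpleGraph V) (w : Sym2 V → ℝ) (v : Finset V → ℝ) :
    Finset V → ℝ :=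
  fun A => ∑ F ∈ pmin G w A, v F

/-- `v` is the characteristic function of a zero-normalized cooperative game on `V`. -/
def IsZeroNormalizedGame (v : Finset V → ℝ) : Prop :=
  v ∅ = 0 ∧ ∀ i, v {i} = 0

/-- Convexity (supermodularity) of a game. -/
def IsConvexGame [DecidableEq V] (v : Finset V → ℝ) : Prop :=
  ∀ A B : Finset V, v A + v B ≤ v (A ∪ B) + v (A ∩ B)

/-- Inheritance of convexity for `P_min` on the weighted graph `(G, w)`. -/
def InheritsConvexity [DecidableEq V] (G : SimpleGraph V) (w : Sym2 V → ℝ) : Prop :=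
  ∀ v : Finset V → ℝ, IsZeroNormalizedGame v → IsConvexGame v →
    IsConvexGame (restrictedGame G w v)

/-- All vertices of the walk `p` are linked to the vertex `z`: each of them is adjacent to `z`
or is `z` itself. -/
def AllLinkedTo (G : SimpleGraph V) {u : V} (p : G.Walk u u) (z : V) : Prop :=
  ∀ x ∈ p.support, x ≠ z → G.Adj z x

/-- The closed walk `p` is complete: its vertices induce a complete subgraph. -/
def IsCompleteCycle (G : SimpleGraph V) {u : V} (p : G.Walk u u) : Prop :=
  G.IsClique {x | x ∈ p.support}

/-- There is at most one chordless cycle containing `e`. Cycles are compared as subgraphs of `G`,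
so the choice of a starting vertex and of an orientation does not matter. -/
def AtMostOneChordlessCycleThrough (G : SimpleGraph V) (e : Sym2 V) : Prop :=
  ∀ (a b : V) (p : G.Walk a a) (q : G.Walk b b),
    p.IsCycle → p.IsChordless → e ∈ p.edges →
    q.IsCycle → q.IsChordless → e ∈ q.edges →
    p.toSubgraph = q.toSubgraph

end PminGame

/-! Let `s`, `t` be the ends of `e₁` and let `K` be `G` without `e₁`. If `A` misses `s` or `t`, all
edges of `A` are minimal, so the restricted game is `0` there; otherwise it is the sum of `v` over
the components of `K[A]`.

Necessity: only unanimity games of pairs are tested. They yield `WalksMeet`: the common vertices of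
two `a`–`b` walks in `K`, together with `s` and `t`, already connect `a` to `b`. Applied to the two
paths left by chordless cycles through `e₁`, this gives condition 1; applied to the arcs of a cycle
of `K`, it gives condition 2.

Sufficiency: supermodularity need only be checked for adding two vertices `i`, `j` to `A`. By
`componentWorth_local` it can fail only if two components of `K[A]` both touch `i` and `j`. Paths
through these components form a cycle of `K`, and condition 2 then makes `i` and `j` common
neighbours of `s` and `t`. The two triangles on `e₁` contradict condition 1 (`eq_of_touches`). -/

namespace PminGame

/-! ### Supermodular set functions and unanimity games of pairs. -/

section Games

variable {V : Type*} [DecidableEq V]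

/-- A set function whose marginals are locally increasing is supermodular. -/
theorem isConvexGame_of_local {f : Finset V → ℝ}
    (h : ∀ (S : Finset V) (i j : V), i ∉ S → j ∉ S → i ≠ j →
      f (insert i S) + f (insert j S) ≤ f (insert j (insert i S)) + f S) :
    IsConvexGame f := by
  have marginal : ∀ (T A : Finset V) (i : V), i ∉ A ∪ T → Disjoint A T →
      f (insert i A) + f (A ∪ T) ≤ f (insert i (A ∪ T)) + f A := by
    intro T
    induction T using Finset.induction_on with
    | empty => intro A i _ _; simp
    | insert a T ha ih =>
      intro A i hi hd
      simp only [Finset.union_insert, Finset.mem_insert, not_or] at hi ⊢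
      rw [Finset.disjoint_insert_right] at hd
      have h₁ := ih A i hi.2 hd.2
      have h₂ := h (A ∪ T) a i (by simp [ha, hd.1]) hi.2 (Ne.symm hi.1)
      linarith
  have increment : ∀ T A B : Finset V, A ⊆ B → Disjoint B T →
      f (A ∪ T) + f B ≤ f (B ∪ T) + f A := by
    intro T
    induction T using Finset.induction_on with
    | empty => intro A B _ _; simp [add_comm]
    | insert a T ha ih =>
      intro A B hAB hd
      rw [Finset.disjoint_insert_right] at hd
      have h₁ := ih A B hAB hd.2
      have h₂ := marginal (B \ A) (A ∪ T) a (by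
        simp only [Finset.mem_union, Finset.mem_sdiff, not_or]
        exact ⟨⟨fun x => hd.1 (hAB x), ha⟩, fun x => hd.1 x.1⟩) (by
        rw [Finset.disjoint_union_left]
        exact ⟨Finset.disjoint_sdiff, (hd.2.mono_left Finset.sdiff_subset).symm⟩)
      have h₃ : A ∪ T ∪ B \ A = B ∪ T := by
        rw [Finset.union_right_comm, Finset.union_sdiff_of_subset hAB]
      rw [h₃] at h₂
      simp only [Finset.union_insert]
      linarith
  intro A B
  -- Adding `B \ A` gains at least as much on `A` as on `A ∩ B`.
  have := increment (B \ A) (A ∩ B) A Finset.inter_subset_left Finset.disjoint_sdiff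
  have e₁ : A ∩ B ∪ B \ A = B := by
    rw [Finset.inter_comm, Finset.union_comm, Finset.sdiff_union_inter]
  have e₂ : A ∪ B \ A = A ∪ B := Finset.union_sdiff_self_eq_union
  rw [e₁, e₂] at this
  linarith

variable {v : Finset V → ℝ}

theorem IsConvexGame.add_le_union (hv : IsConvexGame v) (h0 : v ∅ = 0) {A B : Finset V}
    (h : Disjoint A B) : v A + v B ≤ v (A ∪ B) := by
  have := hv A B
  rw [Finset.disjoint_iff_inter_eq_empty.mp h, h0] at this
  linarith

theorem IsConvexGame.le_insert (hv : IsConvexGame v) (hz : IsZeroNormalizedGame v)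
    (i : V) (A : Finset V) : v A ≤ v (insert i A) := by
  by_cases hi : i ∈ A
  · rw [Finset.insert_eq_of_mem hi]
  · have := hv.add_le_union hz.1 (Finset.disjoint_singleton_left.mpr hi)
    rw [← Finset.insert_eq, hz.2] at this
    linarith

theorem IsConvexGame.nonneg (hv : IsConvexGame v) (hz : IsZeroNormalizedGame v)
    (A : Finset V) : 0 ≤ v A := by
  induction A using Finset.induction_on with
  | empty => rw [hz.1]
  | insert i A _ ih => exact ih.trans (hv.le_insert hz i A)

theorem IsConvexGame.sum_le_biUnion (hv : IsConvexGame v) (h0 : v ∅ = 0)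
    (P : Finset (Finset V)) (hP : (P : Set (Finset V)).PairwiseDisjoint id) :
    ∑ F ∈ P, v F ≤ v (P.biUnion id) := by
  induction P using Finset.induction_on with
  | empty => simp [h0]
  | insert F P hF ih =>
    rw [Finset.sum_insert hF, Finset.biUnion_insert]
    have h₁ := ih (hP.subset (by simp))
    have h₂ : Disjoint (id F) (P.biUnion id) := by
      rw [Finset.disjoint_biUnion_right]
      intro F' hF'
      exact hP (by simp) (by simp [hF']) (by rintro rfl; exact hF hF')
    have := hv.add_le_union h0 h₂
    simp only [id] at this ⊢
    linarith

/-- The unanimity game of `{a, b}`. -/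
def pairGame (a b : V) : Finset V → ℝ := fun S => if a ∈ S ∧ b ∈ S then 1 else 0

theorem pairGame_isZeroNormalizedGame {a b : V} (hab : a ≠ b) :
    IsZeroNormalizedGame (pairGame a b) := by
  refine ⟨by simp [pairGame], fun i => ?_⟩
  simp only [pairGame, Finset.mem_singleton, ite_eq_right_iff]
  rintro ⟨rfl, rfl⟩
  exact absurd rfl hab

theorem pairGame_isConvexGame (a b : V) : IsConvexGame (pairGame a b) := by
  intro A B
  simp only [pairGame, Finset.mem_union, Finset.mem_inter]
  by_cases h₁ : a ∈ A <;> by_cases h₂ : b ∈ A <;> by_cases h₃ : a ∈ B <;>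
    by_cases h₄ : b ∈ B <;> simp [h₁, h₂, h₃, h₄]

end Games

/-! ### Components of induced subgraphs and their total worth. -/

section Blocks

variable {V : Type*}

theorem mem_of_reachable {K : SimpleGraph V} {D : Set V}
    (hD : ∀ z z', z ∈ D → K.Adj z z' → z' ∈ D) {x y : V} (hx : x ∈ D)
    (h : K.Reachable x y) : y ∈ D := by
  obtain ⟨p⟩ := h
  induction p with
  | nil => exact hx
  | cons hadj _ ih => exact ih (hD _ _ hx hadj)

/-- The graph `K` without the edges that leave `A`. -/
def restrictTo (K : SimpleGraph V) (A : Finset V) : SimpleGraph V where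
  Adj x y := K.Adj x y ∧ x ∈ A ∧ y ∈ A
  symm := ⟨fun _ _ h => ⟨h.1.symm, h.2.2, h.2.1⟩⟩
  loopless := ⟨fun _ h => h.1.ne rfl⟩

theorem reachable_restrictTo_of_walk {K : SimpleGraph V} {A : Finset V} {x y : V} (p : K.Walk x y)
    (hp : ∀ z ∈ p.support, z ∈ A) : (restrictTo K A).Reachable x y := by
  induction p with
  | nil => exact .refl _
  | cons hadj p ih =>
    refine .trans (SimpleGraph.Adj.reachable (G := restrictTo K A)
      ⟨hadj, hp _ (by simp), hp _ (by simp)⟩) (ih fun z hz => hp z (by simp [hz]))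

/-- The second conjunct keeps the walk inside the block of `x`; `exists_path_through_block` relies
on it. -/
theorem exists_walk_of_reachable_restrictTo {K : SimpleGraph V} {A : Finset V} {x y : V}
    (hx : x ∈ A) (h : (restrictTo K A).Reachable x y) :
    ∃ p : K.Walk x y, ∀ z ∈ p.support, z ∈ A ∧ (restrictTo K A).Reachable x z := by
  obtain ⟨p⟩ := h
  induction p with
  | nil => exact ⟨.nil, by simpa using hx⟩
  | cons hadj p ih =>
    obtain ⟨q, hq⟩ := ih hadj.2.2
    refine ⟨.cons hadj.1 q, fun z hz => ?_⟩
    rw [SimpleGraph.Walk.support_cons, List.mem_cons] at hz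
    rcases hz with rfl | hz
    · exact ⟨hx, .refl _⟩
    · exact ⟨(hq z hz).1, hadj.reachable.trans (hq z hz).2⟩

theorem restrictTo_mono {K : SimpleGraph V} {A B : Finset V} (h : A ⊆ B) :
    restrictTo K A ≤ restrictTo K B := fun _ _ hxy => ⟨hxy.1, h hxy.2.1, h hxy.2.2⟩

open Classical in
/-- The block of `x` in the partition of `A` into connected components of `K`. -/
noncomputable def block (K : SimpleGraph V) (A : Finset V) (x : V) : Finset V :=
  A.filter fun y => K.Reachable x y

open Classical in
/-- The partition of `A` into traces of connected components of `K`. -/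
noncomputable def blocks (K : SimpleGraph V) (A : Finset V) : Finset (Finset V) :=
  A.image (block K A)

theorem pmin_eq_blocks (G : SimpleGraph V) (w : Sym2 V → ℝ) (A : Finset V) :
    pmin G w A = blocks (pminGraph G w A) A := rfl

theorem mem_block {K : SimpleGraph V} {A : Finset V} {x y : V} :
    y ∈ block K A x ↔ y ∈ A ∧ K.Reachable x y := by
  simp [block]

theorem mem_blocks {K : SimpleGraph V} {A F : Finset V} :
    F ∈ blocks K A ↔ ∃ x ∈ A, block K A x = F := by
  simp [blocks]

theorem self_mem_block {K : SimpleGraph V} {A : Finset V} {x : V} (hx : x ∈ A) :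
    x ∈ block K A x := mem_block.mpr ⟨hx, .refl _⟩

theorem block_eq_of_reachable {K : SimpleGraph V} {A : Finset V} {x y : V}
    (h : K.Reachable x y) : block K A x = block K A y := by
  ext z
  simp only [mem_block]
  exact and_congr_right fun _ => ⟨h.symm.trans, h.trans⟩

theorem block_eq_of_mem_blocks {K : SimpleGraph V} {A F : Finset V} (hF : F ∈ blocks K A) {x : V}
    (hx : x ∈ F) : block K A x = F := by
  obtain ⟨y, _, rfl⟩ := mem_blocks.mp hF
  exact (block_eq_of_reachable (mem_block.mp hx).2).symm

theorem subset_of_mem_blocks {K : SimpleGraph V} {A F : Finset V} (hF : F ∈ blocks K A) :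
    F ⊆ A := by
  obtain ⟨y, _, rfl⟩ := mem_blocks.mp hF
  exact fun z hz => (mem_block.mp hz).1

theorem blocks_pairwiseDisjoint (K : SimpleGraph V) (A : Finset V) :
    (blocks K A : Set (Finset V)).PairwiseDisjoint id := by
  intro F hF F' hF' hne
  refine Finset.disjoint_left.mpr fun x hx hx' => hne ?_
  rw [← block_eq_of_mem_blocks hF hx, ← block_eq_of_mem_blocks hF' hx']

/-- The sum of the worths of the components of the subgraph of `K` induced by `A`. -/
noncomputable def componentWorth (K : SimpleGraph V) (v : Finset V → ℝ) (A : Finset V) : ℝ :=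
  ∑ F ∈ blocks (restrictTo K A) A, v F

/-- Some member of `F` is a neighbour of `i`. -/
def Touches (K : SimpleGraph V) (i : V) (F : Finset V) : Prop := ∃ x ∈ F, K.Adj i x

variable [DecidableEq V]

open Classical in
-- A block not touching `i` stays closed under adjacency in the larger graph, while all touched
-- blocks fuse through `i`.
theorem blocks_insert (K : SimpleGraph V) {A : Finset V} {i : V} (hi : i ∉ A) :
    blocks (restrictTo K (insert i A)) (insert i A) =
      insert (insert i (((blocks (restrictTo K A) A).filter (Touches K i)).biUnion id))
        ((blocks (restrictTo K A) A).filter fun F => ¬ Touches K i F) := by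
  have hle : restrictTo K A ≤ restrictTo K (insert i A) := restrictTo_mono (by simp)
  have untouched : ∀ x ∈ A, ¬ Touches K i (block (restrictTo K A) A x) →
      block (restrictTo K (insert i A)) (insert i A) x = block (restrictTo K A) A x := by
    intro x hx ht
    ext y
    refine ⟨fun hy => ?_, fun hy => ?_⟩
    · refine mem_of_reachable (D := (block (restrictTo K A) A x : Set V)) ?_
        (self_mem_block hx) (mem_block.mp hy).2
      rintro z z' hz ⟨hadj, -, hz'⟩
      have hz := Finset.mem_coe.mp hz
      rcases Finset.mem_insert.mp hz' with rfl | hz'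
      · exact (ht ⟨z, hz, hadj.symm⟩).elim
      · exact mem_block.mpr ⟨hz', (mem_block.mp hz).2.trans
          (SimpleGraph.Adj.reachable (G := restrictTo K A) ⟨hadj, (mem_block.mp hz).1, hz'⟩)⟩
    · exact mem_block.mpr ⟨by simp [(mem_block.mp hy).1], (mem_block.mp hy).2.mono hle⟩
  have touched : ∀ x ∈ A, Touches K i (block (restrictTo K A) A x) →
      (restrictTo K (insert i A)).Reachable i x := by
    rintro x hx ⟨u, hu, hadj⟩
    refine .trans (SimpleGraph.Adj.reachable (v := u)
      ⟨hadj, by simp, by simp [(mem_block.mp hu).1]⟩) ?_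
    exact (mem_block.mp hu).2.symm.mono hle
  have new : block (restrictTo K (insert i A)) (insert i A) i =
      insert i (((blocks (restrictTo K A) A).filter (Touches K i)).biUnion id) := by
    ext y
    refine ⟨fun hy => ?_, fun hy => ?_⟩
    · refine mem_of_reachable (D := (insert i (((blocks (restrictTo K A) A).filter
        (Touches K i)).biUnion id) : Finset V)) ?_ (by simp) (mem_block.mp hy).2
      rintro z z' hz ⟨hadj, -, hz'⟩
      rcases Finset.mem_insert.mp hz' with rfl | hzA
      · simp
      · simp only [Finset.mem_coe, Finset.mem_insert, Finset.mem_biUnion, Finset.mem_filter,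
          id] at hz ⊢
        right
        rcases hz with rfl | ⟨F, ⟨hF, ht⟩, hz⟩
        · exact ⟨_, ⟨mem_blocks.mpr ⟨z', hzA, rfl⟩, z', self_mem_block hzA, hadj⟩,
            self_mem_block hzA⟩
        · refine ⟨F, ⟨hF, ht⟩, ?_⟩
          rw [← block_eq_of_mem_blocks hF hz]
          exact mem_block.mpr ⟨hzA, SimpleGraph.Adj.reachable (G := restrictTo K A)
            ⟨hadj, subset_of_mem_blocks hF hz, hzA⟩⟩
    · simp only [Finset.mem_insert, Finset.mem_biUnion, Finset.mem_filter, id] at hy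
      rcases hy with rfl | ⟨F, ⟨hF, ht⟩, hy⟩
      · exact self_mem_block (by simp)
      · have hyA := subset_of_mem_blocks hF hy
        rw [← block_eq_of_mem_blocks hF hy] at ht
        exact mem_block.mpr ⟨by simp [hyA], touched y hyA ht⟩
  ext F
  rw [mem_blocks, Finset.mem_insert, Finset.mem_filter]
  constructor
  · rintro ⟨x, hx, rfl⟩
    rcases Finset.mem_insert.mp hx with rfl | hx
    · exact Or.inl new
    · by_cases ht : Touches K i (block (restrictTo K A) A x)
      · left
        rw [← new]
        exact (block_eq_of_reachable (touched x hx ht)).symm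
      · right
        rw [untouched x hx ht]
        exact ⟨mem_blocks.mpr ⟨x, hx, rfl⟩, ht⟩
  · rintro (rfl | ⟨hF, ht⟩)
    · exact ⟨i, by simp, new⟩
    · obtain ⟨x, hx, rfl⟩ := mem_blocks.mp hF
      exact ⟨x, by simp [hx], untouched x hx ht⟩

open Classical in
theorem componentWorth_insert (K : SimpleGraph V) (v : Finset V → ℝ) {A : Finset V} {i : V}
    (hi : i ∉ A) :
    componentWorth K v (insert i A) =
      v (insert i (((blocks (restrictTo K A) A).filter (Touches K i)).biUnion id)) +
        ∑ F ∈ (blocks (restrictTo K A) A).filter (fun F => ¬ Touches K i F), v F := by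
  rw [componentWorth, blocks_insert K hi, Finset.sum_insert]
  intro h
  exact hi (subset_of_mem_blocks (Finset.mem_filter.mp h).1 (Finset.mem_insert_self _ _))

theorem componentWorth_le_insert (K : SimpleGraph V) {v : Finset V → ℝ}
    (hz : IsZeroNormalizedGame v) (hv : IsConvexGame v) {A : Finset V} {i : V} (hi : i ∉ A) :
    componentWorth K v A ≤ componentWorth K v (insert i A) := by
  classical
  rw [componentWorth_insert K v hi, componentWorth,
    ← Finset.sum_filter_add_sum_filter_not _ (Touches K i)]
  have h₁ := hv.sum_le_biUnion hz.1 ((blocks (restrictTo K A) A).filter (Touches K i))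
    ((blocks_pairwiseDisjoint (restrictTo K A) A).subset
      (Finset.coe_subset.mpr (Finset.filter_subset _ _)))
  have h₂ := hv.le_insert hz i (((blocks (restrictTo K A) A).filter (Touches K i)).biUnion id)
  linarith

/-- If at most one component meets both neighbourhoods, then the worth is supermodular locally. -/
theorem componentWorth_local (K : SimpleGraph V) {v : Finset V → ℝ}
    (hz : IsZeroNormalizedGame v) (hv : IsConvexGame v) {A : Finset V} {i j : V} (hi : i ∉ A)
    (hj : j ∉ A) (hij : i ≠ j)
    (h : ∀ F ∈ blocks (restrictTo K A) A, ∀ F' ∈ blocks (restrictTo K A) A,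
      Touches K i F → Touches K j F → Touches K i F' → Touches K j F' → F = F') :
    componentWorth K v (insert i A) + componentWorth K v (insert j A) ≤
      componentWorth K v (insert j (insert i A)) + componentWorth K v A := by
  classical
  have hji : j ∉ insert i A := by simp [hij.symm, hj]
  rw [componentWorth_insert K v hji, blocks_insert K hi, componentWorth_insert K v hi,
    componentWorth_insert K v hj, componentWorth]
  have hdisj := blocks_pairwiseDisjoint (restrictTo K A) A
  have hsub : ∀ F ∈ blocks (restrictTo K A) A, F ⊆ A := fun F => subset_of_mem_blocks
  generalize blocks (restrictTo K A) A = P at *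
  set Di := insert i ((P.filter (Touches K i)).biUnion id) with hDi
  set Dj := insert j ((P.filter (Touches K j)).biUnion id) with hDj
  have hDiP : Di ∉ P := fun hP => hi (hsub _ hP (by simp [hDi]))
  have split_i := Finset.sum_filter_add_sum_filter_not P (Touches K i) v
  have split_ij := Finset.sum_filter_add_sum_filter_not (P.filter (Touches K i)) (Touches K j) v
  have split_ij' := Finset.sum_filter_add_sum_filter_not (P.filter fun F => ¬ Touches K i F)
    (Touches K j) v
  have split_ji := Finset.sum_filter_add_sum_filter_not (P.filter fun F => ¬ Touches K j F)
    (Touches K i) v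
  rw [Finset.filter_comm] at split_ji
  rw [Finset.filter_comm (p := fun F => ¬ Touches K j F) (q := fun F => ¬ Touches K i F)]
    at split_ji
  -- `Di` and `Dj` are the blocks of `i` and `j` after adding one vertex. If `j` touches `Di` they
  -- fuse into `Di ∪ Dj`, and convexity of `v` is applied to this pair; otherwise no component
  -- touches both vertices and equality holds.
  by_cases ht : Touches K j Di
  · rw [Finset.filter_insert, if_pos ht, Finset.filter_insert, if_neg (by simpa using ht),
      Finset.biUnion_insert]
    have hunion : insert j (id Di ∪ ((P.filter fun F => ¬ Touches K i F).filter
        (Touches K j)).biUnion id) = Di ∪ Dj := by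
      ext x
      simp only [hDi, hDj, id, Finset.mem_insert, Finset.mem_union, Finset.mem_biUnion,
        Finset.mem_filter]
      constructor
      · rintro (h | (h | h) | ⟨F, ⟨⟨h₁, h₂⟩, h₃⟩, h₄⟩) <;> grind
      · rintro ((h | h) | (h | ⟨F, ⟨h₁, h₂⟩, h₃⟩))
        · grind
        · grind
        · grind
        · by_cases h₄ : Touches K i F
          · exact Or.inr (Or.inl (Or.inr ⟨F, ⟨h₁, h₄⟩, h₃⟩))
          · exact Or.inr (Or.inr ⟨F, ⟨⟨h₁, h₄⟩, h₂⟩, h₃⟩)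
    have hinter : Di ∩ Dj = ((P.filter (Touches K i)).filter (Touches K j)).biUnion id := by
      ext x
      simp only [hDi, hDj, id, Finset.mem_insert, Finset.mem_inter, Finset.mem_biUnion,
        Finset.mem_filter]
      constructor
      · rintro ⟨rfl | ⟨F, ⟨hF, h₁⟩, hx⟩, rfl | ⟨F', ⟨hF', h₂⟩, hx'⟩⟩
        · exact (hij rfl).elim
        · exact (hi (hsub _ hF' hx')).elim
        · exact (hj (hsub _ hF hx)).elim
        · obtain rfl : F = F' := by
            by_contra hne
            exact Finset.disjoint_left.mp (hdisj hF hF' hne) hx hx'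
          exact ⟨F, ⟨⟨hF, h₁⟩, h₂⟩, hx⟩
      · rintro ⟨F, ⟨⟨hF, h₁⟩, h₂⟩, hx⟩
        exact ⟨Or.inr ⟨F, ⟨hF, h₁⟩, hx⟩, Or.inr ⟨F, ⟨hF, h₂⟩, hx⟩⟩
    -- The uniqueness hypothesis enters here: with several common components, `v` of their union
    -- could exceed the sum of their worths.
    have hval : v (Di ∩ Dj) = ∑ F ∈ (P.filter (Touches K i)).filter (Touches K j), v F := by
      rw [hinter]
      have hcard : ((P.filter (Touches K i)).filter (Touches K j)).card ≤ 1 := by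
        rw [Finset.card_le_one]
        intro F hF F' hF'
        simp only [Finset.mem_filter] at hF hF'
        exact h F hF.1.1 F' hF'.1.1 hF.1.2 hF.2 hF'.1.2 hF'.2
      rcases Finset.card_le_one_iff_subset_singleton.mp hcard with ⟨F, hF⟩
      rcases Finset.subset_singleton_iff.mp hF with h0 | h1
      · rw [h0]; simp [hz.1]
      · rw [h1]; simp
    rw [hunion]
    have := hv Di Dj
    linarith
  · rw [Finset.filter_insert, if_neg ht, Finset.filter_insert, if_pos ht, Finset.sum_insert
      (by simp [hDiP])]
    have hnone : (P.filter (Touches K i)).filter (Touches K j) = ∅ := by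
      rw [Finset.filter_eq_empty_iff]
      rintro F hF ⟨x, hx, hadj⟩
      exact ht ⟨x, Finset.mem_insert_of_mem (Finset.mem_biUnion.mpr ⟨F, hF, hx⟩), hadj⟩
    have hsame : (P.filter fun F => ¬ Touches K i F).filter (Touches K j) =
        P.filter (Touches K j) := by
      ext F
      simp only [Finset.mem_filter]
      refine ⟨fun h => ⟨h.1.1, h.2⟩, fun h => ⟨⟨h.1, fun h' => ?_⟩, h.2⟩⟩
      exact Finset.notMem_empty F (hnone ▸ by simp [h.1, h.2, h'])
    rw [hsame] at split_ij' ⊢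
    rw [hnone, Finset.sum_empty] at split_ij
    linarith

/-- The block of `a` is the only one that can have positive worth in the game `pairGame a b`. -/
theorem sum_blocks_pairGame (K : SimpleGraph V) (A : Finset V) (a b : V)
    [Decidable (a ∈ A ∧ b ∈ A ∧ K.Reachable a b)] :
    ∑ F ∈ blocks K A, pairGame a b F = if a ∈ A ∧ b ∈ A ∧ K.Reachable a b then 1 else 0 := by
  by_cases ha : a ∈ A
  · rw [Finset.sum_eq_single (block K A a)]
    · exact if_congr (by simp [mem_block, ha]) rfl rfl
    · intro F hF hne
      simp only [pairGame, ite_eq_right_iff]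
      rintro ⟨h, -⟩
      exact (hne (block_eq_of_mem_blocks hF h).symm).elim
    · intro h
      exact (h (mem_blocks.mpr ⟨a, ha, rfl⟩)).elim
  · rw [Finset.sum_eq_zero]
    · simp [ha]
    · intro F hF
      have : a ∉ F := fun h => ha (subset_of_mem_blocks hF h)
      simp [pairGame, this]

end Blocks

/-! ### Arcs of cycles and chordless cycles. -/

section Walks

open SimpleGraph

variable {V : Type*} {K : SimpleGraph V}

theorem eq_or_eq_of_mem_support_of_isCycle_append {a b z : V} {p : K.Walk a b} {q : K.Walk b a}
    (h : (p.append q).IsCycle) (hp : z ∈ p.support) (hq : z ∈ q.support) : z = a ∨ z = b := by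
  have hnd := h.support_nodup
  rw [Walk.tail_support_append, List.nodup_append'] at hnd
  rcases (Walk.mem_support_iff p).mp hp with rfl | hp
  · exact Or.inl rfl
  · rcases (Walk.mem_support_iff q).mp hq with rfl | hq
    · exact Or.inr rfl
    · exact (hnd.2.2 hp hq).elim

/-- Two vertices of a cycle are joined by its two arcs. -/
theorem exists_arcs {u : V} {c : K.Walk u u} (hc : c.IsCycle) {a b : V} (ha : a ∈ c.support)
    (hb : b ∈ c.support) :
    ∃ p q : K.Walk a b, ∀ z, z ∈ p.support → z ∈ q.support → z = a ∨ z = b := by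
  classical
  have hr : (c.rotate a ha).IsCycle := (Walk.isCycle_rotate ha).mpr hc
  have hbr : b ∈ (c.rotate a ha).support := (Walk.mem_support_rotate_iff _ _ _).mpr hb
  generalize c.rotate a ha = d at hr hbr
  rw [← d.take_spec hbr] at hr
  refine ⟨d.takeUntil b hbr, (d.dropUntil b hbr).reverse, fun z hz hz' => ?_⟩
  exact eq_or_eq_of_mem_support_of_isCycle_append hr hz (by simpa using hz')

/-- Two vertices of a cycle are joined to a third one by arcs that meet only there. -/
theorem exists_fan {u : V} {c : K.Walk u u} (hc : c.IsCycle) {a b x : V} (ha : a ∈ c.support)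
    (hb : b ∈ c.support) (hx : x ∈ c.support) (hab : a ≠ b) (hax : a ≠ x) :
    ∃ (p : K.Walk a x) (q : K.Walk b x), ∀ z, z ∈ p.support → z ∈ q.support → z = x := by
  classical
  have hr : (c.rotate x hx).IsCycle := (Walk.isCycle_rotate hx).mpr hc
  have har : a ∈ (c.rotate x hx).support := (Walk.mem_support_rotate_iff _ _ _).mpr ha
  have hbr : b ∈ (c.rotate x hx).support := (Walk.mem_support_rotate_iff _ _ _).mpr hb
  generalize c.rotate x hx = d at hr har hbr
  rw [← d.take_spec har] at hr hbr
  generalize d.takeUntil a har = p at hr hbr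
  generalize d.dropUntil a har = q at hr hbr
  -- The cycle is cut at `x` and `a`. Whichever arc contains `b`, its piece between `b` and `x`
  -- avoids `a`; the other arc serves `a`.
  rcases (Walk.mem_support_append_iff _ _).mp hbr with hbp | hbq
  · have hp : p.IsPath := hr.isPath_of_append_left fun h => hax h.eq
    refine ⟨q, (p.takeUntil b hbp).reverse, fun z hz hz' => ?_⟩
    rw [Walk.support_reverse, List.mem_reverse] at hz'
    rcases eq_or_eq_of_mem_support_of_isCycle_append hr
      (p.support_takeUntil_subset_support hbp hz') hz with h | rfl
    · exact h
    · exact (Walk.endpoint_notMem_support_takeUntil hp hbp hab hz').elim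
  · have hq : q.IsPath := hr.isPath_of_append_right fun h => hax h.eq.symm
    refine ⟨p.reverse, q.dropUntil b hbq, fun z hz hz' => ?_⟩
    rw [Walk.support_reverse, List.mem_reverse] at hz
    rcases eq_or_eq_of_mem_support_of_isCycle_append hr hz
      (q.support_dropUntil_subset_support hbq hz') with h | rfl
    · exact h
    · rw [← q.take_spec hbq] at hq
      exact (hq.ne_of_mem_support_of_append hab (Walk.start_mem_support _) hz' rfl).elim

/-- A walk that uses only edges of a path with the same ends visits all vertices of that path. -/
theorem support_subset_of_edges_subset {u v : V} {q r : K.Walk u v} (hq : q.IsPath)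
    (h : ∀ e ∈ r.edges, e ∈ q.edges) : ∀ x ∈ q.support, x ∈ r.support := by
  classical
  intro x hx
  by_contra hxr
  rw [← q.take_spec hx] at hq h
  generalize q.takeUntil x hx = q₁ at hq h
  generalize q.dropUntil x hx = q₂ at hq h
  -- Avoiding `x`, the walk cannot leave `q₁`: edges of `q₂` meet `q₁` only at `x`.
  have key : ∀ {y z : V} (r : K.Walk y z), (∀ e ∈ r.edges, e ∈ (q₁.append q₂).edges) →
      x ∉ r.support → y ∈ q₁.support → z ∈ q₁.support := by
    intro y z r
    induction r with
    | nil => exact fun _ _ h => h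
    | @cons y y' z hadj r ih =>
      intro he hxr hy
      rw [Walk.support_cons, List.mem_cons, not_or] at hxr
      refine ih (fun e h => he e (by simp [h])) hxr.2 ?_
      have hyy := he s(y, y') (by simp)
      rw [Walk.edges_append, List.mem_append] at hyy
      rcases hyy with h' | h'
      · exact q₁.snd_mem_support_of_mem_edges h'
      · exact (hq.ne_of_mem_support_of_append (Ne.symm hxr.1) hy
          (q₂.fst_mem_support_of_mem_edges h') rfl).elim
  have hv := key r h hxr q₁.start_mem_support
  have hvx : v ≠ x := by
    rintro rfl
    exact hxr r.end_mem_support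
  exact hq.ne_of_mem_support_of_append hvx hv q₂.end_mem_support rfl

/-- A cycle through the edge `s(a, b)` consists of this edge and a path from `b` to `a`. -/
theorem exists_path_of_mem_edges_isCycle {u a b : V} {c : K.Walk u u} (hc : c.IsCycle)
    (h : s(a, b) ∈ c.edges) :
    ∃ q : K.Walk b a, q.IsPath ∧ s(a, b) ∉ q.edges ∧
      (∀ e, e ∈ c.edges ↔ e = s(a, b) ∨ e ∈ q.edges) ∧ ∀ x, x ∈ c.support ↔ x ∈ q.support := by
  classical
  have aux : ∀ d : K.Walk a a, d.IsCycle → d.snd = b →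
      ∃ q : K.Walk b a, q.IsPath ∧ s(a, b) ∉ q.edges ∧
      (∀ e, e ∈ d.edges ↔ e = s(a, b) ∨ e ∈ q.edges) ∧ ∀ x, x ∈ d.support ↔ x ∈ q.support := by
    intro d hd hb
    cases d with
    | nil => exact (Walk.not_isCycle_nil hd).elim
    | cons hadj q =>
      obtain rfl : _ = b := by simpa using hb
      rw [Walk.cons_isCycle_iff] at hd
      refine ⟨q, hd.1, hd.2, by simp, fun x => ?_⟩
      rw [Walk.support_cons, List.mem_cons, or_iff_right_of_imp]
      rintro rfl
      exact q.end_mem_support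
  have ha := c.fst_mem_support_of_mem_edges h
  have hr : (c.rotate a ha).IsCycle := (Walk.isCycle_rotate ha).mpr hc
  have hedges : ∀ e, e ∈ (c.rotate a ha).edges ↔ e ∈ c.edges :=
    fun e => (c.rotate_edges a ha).mem_iff
  have hsupp : ∀ x, x ∈ (c.rotate a ha).support ↔ x ∈ c.support :=
    fun x => Walk.mem_support_rotate_iff _ _ _
  simp only [← hedges, ← hsupp] at h ⊢
  generalize c.rotate a ha = d at *
  by_cases hb : d.snd = b
  · exact aux d hr hb
  -- If the edge at `a` is not the first one of the cycle, it is the last one, so reversal brings it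
  -- to the front.
  · have hb' : d.reverse.snd = b := by
      rw [Walk.snd_reverse]
      cases d with
      | nil => exact (Walk.not_isCycle_nil hr).elim
      | @cons _ y _ hadj q =>
        have hq := ((Walk.cons_isCycle_iff _ _).mp hr).1
        rw [Walk.edges_cons, List.mem_cons] at h
        rcases h with h | h
        · simp only [Walk.snd_cons] at hb
          rw [Sym2.congr_right] at h
          exact (hb h.symm).elim
        · rw [Walk.penultimate_cons_of_not_nil _ _ (fun hn => by
            rw [Walk.edges_eq_nil.mpr hn] at h; simp at h)]
          exact (hq.eq_penultimate_of_mem_edges h).symm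
    simpa using aux d.reverse hr.reverse hb'

/-- The vertices of a chordless cycle determine its edges. -/
theorem toSubgraph_eq_of_isChordless {u v : V} {p : K.Walk u u} {q : K.Walk v v}
    (hp : p.IsChordless) (hq : q.IsChordless) (h : ∀ x, x ∈ p.support ↔ x ∈ q.support) :
    p.toSubgraph = q.toSubgraph := by
  ext x y
  · simp [h]
  · simp only [Walk.adj_toSubgraph_iff_mem_edges]
    refine ⟨fun hxy => ?_, fun hxy => ?_⟩
    · exact hq.mem_edges ((h x).mp (p.fst_mem_support_of_mem_edges hxy))
        ((h y).mp (p.snd_mem_support_of_mem_edges hxy)) (p.adj_of_mem_edges hxy)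
    · exact hp.mem_edges ((h x).mpr (q.fst_mem_support_of_mem_edges hxy))
        ((h y).mpr (q.snd_mem_support_of_mem_edges hxy)) (q.adj_of_mem_edges hxy)

end Walks

/-! ### The restricted game, and necessity of the two conditions. -/

section Inheritance

open SimpleGraph

variable {V : Type*}

/-- The edge `s(s, t)` is the only edge of minimum weight `σ₁`; all others have weight `σ₂`. -/
structure UniqueMinEdge (G : SimpleGraph V) (w : Sym2 V → ℝ) (σ₁ σ₂ : ℝ) (s t : V) : Prop where
  adj : G.Adj s t
  lt : σ₁ < σ₂
  weight_eq : w s(s, t) = σ₁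
  weight_of_ne : ∀ e ∈ G.edgeSet, e ≠ s(s, t) → w e = σ₂

/-- The graph without the edge `s(s, t)`. -/
def heavyGraph (G : SimpleGraph V) (s t : V) : SimpleGraph V := G.deleteEdges {s(s, t)}

theorem heavyGraph_adj {G : SimpleGraph V} {s t x y : V} :
    (heavyGraph G s t).Adj x y ↔ G.Adj x y ∧ s(x, y) ≠ s(s, t) := by
  simp [heavyGraph]

theorem mem_edgeSet_heavyGraph {G : SimpleGraph V} {s t : V} {e : Sym2 V} :
    e ∈ (heavyGraph G s t).edgeSet ↔ e ∈ G.edgeSet ∧ e ≠ s(s, t) := by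
  simp [heavyGraph]

theorem heavyGraph_le (G : SimpleGraph V) (s t : V) : heavyGraph G s t ≤ G :=
  fun _ _ h => (heavyGraph_adj.mp h).1

theorem not_heavyGraph_adj (G : SimpleGraph V) (s t : V) : ¬ (heavyGraph G s t).Adj s t :=
  fun h => (heavyGraph_adj.mp h).2 rfl

section RestrictedGame

variable {G : SimpleGraph V} {w : Sym2 V → ℝ} {σ₁ σ₂ : ℝ} {s t : V}

theorem UniqueMinEdge.pminGraph_eq (h : UniqueMinEdge G w σ₁ σ₂ s t) {A : Finset V} (hs : s ∈ A)
    (ht : t ∈ A) : pminGraph G w A = restrictTo (heavyGraph G s t) A := by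
  have hst : s(s, t) ∈ inducedEdges G A := ⟨h.adj, by simp [hs, ht]⟩
  have hmin : minEdges G w A = {s(s, t)} := by
    ext e
    rw [Set.mem_singleton_iff]
    constructor
    · rintro ⟨he, hle⟩
      by_contra hne
      have h₁ := hle _ hst
      rw [h.weight_eq, h.weight_of_ne e he.1 hne] at h₁
      exact absurd h.lt (not_lt.mpr h₁)
    · rintro rfl
      refine ⟨hst, fun e he => ?_⟩
      by_cases hne : e = s(s, t)
      · rw [hne]
      · rw [h.weight_eq, h.weight_of_ne e he.1 hne]
        exact h.lt.le
  ext x y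
  rw [pminGraph, hmin, fromEdgeSet_adj]
  simp only [inducedEdges, restrictTo, heavyGraph_adj, Set.mem_sdiff, Set.mem_ofPred_eq,
    Set.mem_singleton_iff, mem_edgeSet, Sym2.mem_iff, forall_eq_or_imp, forall_eq]
  exact ⟨fun h => ⟨⟨h.1.1.1, h.1.2⟩, h.1.1.2⟩, fun h => ⟨⟨⟨h.1.1, h.2⟩, h.1.2⟩, h.1.1.ne⟩⟩

theorem UniqueMinEdge.pminGraph_eq_bot (h : UniqueMinEdge G w σ₁ σ₂ s t) {A : Finset V}
    (hA : ¬ (s ∈ A ∧ t ∈ A)) : pminGraph G w A = ⊥ := by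
  have hne : ∀ e ∈ inducedEdges G A, w e = σ₂ := by
    rintro e ⟨he, hmem⟩
    refine h.weight_of_ne e he ?_
    rintro rfl
    exact hA ⟨hmem s (by simp), hmem t (by simp)⟩
  have hmin : inducedEdges G A \ minEdges G w A = ∅ :=
    Set.sdiff_eq_empty.mpr fun e he => ⟨he, fun e' he' => (hne e he).trans (hne e' he').symm |>.le⟩
  rw [pminGraph, hmin, fromEdgeSet_empty]

theorem UniqueMinEdge.restrictedGame_eq (h : UniqueMinEdge G w σ₁ σ₂ s t) (v : Finset V → ℝ)
    {A : Finset V} (hs : s ∈ A) (ht : t ∈ A) :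
    restrictedGame G w v A = componentWorth (heavyGraph G s t) v A := by
  rw [restrictedGame, pmin_eq_blocks, h.pminGraph_eq hs ht, componentWorth]

theorem UniqueMinEdge.restrictedGame_eq_zero (h : UniqueMinEdge G w σ₁ σ₂ s t)
    {v : Finset V → ℝ} (hz : IsZeroNormalizedGame v) {A : Finset V} (hA : ¬ (s ∈ A ∧ t ∈ A)) :
    restrictedGame G w v A = 0 := by
  rw [restrictedGame, pmin_eq_blocks, h.pminGraph_eq_bot hA]
  refine Finset.sum_eq_zero fun F hF => ?_
  obtain ⟨x, hx, rfl⟩ := mem_blocks.mp hF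
  have : block ⊥ A x = {x} := by
    ext y
    rw [mem_block, Finset.mem_singleton, reachable_bot]
    exact ⟨fun h => h.2.symm, fun h => ⟨h ▸ hx, h.symm⟩⟩
  rw [this, hz.2]

end RestrictedGame

/-- Any two walks with the same ends meet in a set which, together with `s` and `t`, still joins
their ends. -/
def WalksMeet (K : SimpleGraph V) (s t : V) : Prop :=
  ∀ ⦃a b : V⦄, a ≠ b → ∀ (p q : K.Walk a b) (T : Finset V), s ∈ T → t ∈ T →
    (∀ z, z ∈ p.support → z ∈ q.support → z ∈ T) → (restrictTo K T).Reachable a b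

theorem WalksMeet.symm {K : SimpleGraph V} {s t : V} (h : WalksMeet K s t) : WalksMeet K t s :=
  fun _ _ hab p q T ht hs hT => h hab p q T hs ht hT

variable [DecidableEq V]

/-- The unanimity game of `{a, b}` is restricted to the indicator of "`a` and `b` are connected" on
sets containing `s` and `t`. The supports of both walks, enlarged by `s` and `t`, are worth `1`;
convexity then forces worth `1` on their intersection. -/
theorem UniqueMinEdge.walksMeet {G : SimpleGraph V} {w : Sym2 V → ℝ} {σ₁ σ₂ : ℝ} {s t : V}
    (h : UniqueMinEdge G w σ₁ σ₂ s t) (hG : InheritsConvexity G w) :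
    WalksMeet (heavyGraph G s t) s t := by
  classical
  intro a b hab p q T hs ht hT
  have hconv := hG _ (pairGame_isZeroNormalizedGame hab) (pairGame_isConvexGame a b)
  have value : ∀ A, s ∈ A → t ∈ A → restrictedGame G w (pairGame a b) A =
      if a ∈ A ∧ b ∈ A ∧ (restrictTo (heavyGraph G s t) A).Reachable a b then 1 else 0 := by
    intro A hs ht
    rw [h.restrictedGame_eq _ hs ht, componentWorth, sum_blocks_pairGame]
  have one : ∀ r : (heavyGraph G s t).Walk a b,
      restrictedGame G w (pairGame a b) (r.support.toFinset ∪ {s, t}) = 1 := by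
    intro r
    rw [value _ (by simp) (by simp), if_pos ⟨by simp, by simp,
      reachable_restrictTo_of_walk r fun z hz => by simp [hz]⟩]
  have hpq := hconv (p.support.toFinset ∪ {s, t}) (q.support.toFinset ∪ {s, t})
  rw [one, one, value _ (by simp) (by simp), value _ (by simp) (by simp)] at hpq
  by_contra hcon
  rw [if_neg (c := _ ∧ _ ∧ (restrictTo (heavyGraph G s t)
    ((p.support.toFinset ∪ {s, t}) ∩ (q.support.toFinset ∪ {s, t}))).Reachable a b)] at hpq
  · split_ifs at hpq <;> norm_num at hpq
  · rintro ⟨-, -, hr⟩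
    refine hcon (hr.mono (restrictTo_mono fun z hz => ?_))
    simp only [Finset.mem_inter, Finset.mem_union, List.mem_toFinset, Finset.mem_insert,
      Finset.mem_singleton] at hz
    by_cases hzs : z = s
    · exact hzs ▸ hs
    by_cases hzt : z = t
    · exact hzt ▸ ht
    simp only [hzs, hzt, or_false] at hz
    exact hT z hz.1 hz.2

/-- Since `s` and `t` are not adjacent, a path from `a` to `b` in this set has at most one inner
vertex. -/
theorem adj_of_reachable_restrictTo {K : SimpleGraph V} {s t a b : V} (hst : ¬ K.Adj s t)
    (hab : a ≠ b) (h : (restrictTo K {a, b, s, t}).Reachable a b) :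
    K.Adj a b ∨ (K.Adj s a ∧ K.Adj s b) ∨ (K.Adj t a ∧ K.Adj t b) := by
  by_contra! hcon
  obtain ⟨h₁, h₂, h₃⟩ := hcon
  have hts : ¬ K.Adj t s := fun h => hst h.symm
  -- If all three alternatives fail, this set is closed under adjacency, yet it does not contain
  -- `b`.
  have hb : b ∈ {z | z = a ∨ z ≠ b ∧ (z = s ∨ z = t) ∧ K.Adj z a} := by
    refine mem_of_reachable ?_ (by simp) h
    rintro z z' hz ⟨hadj, -, hz'⟩
    simp only [Set.mem_ofPred_eq, Finset.mem_insert, Finset.mem_singleton] at hz hz' ⊢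
    by_cases hza : z' = a
    · exact Or.inl hza
    right
    have hzb : z' ≠ b := by
      rintro rfl
      rcases hz with rfl | ⟨-, rfl | rfl, hz⟩
      · exact h₁ hadj
      · exact h₂ hz hadj
      · exact h₃ hz hadj
    refine ⟨hzb, by tauto, ?_⟩
    rcases hz with rfl | ⟨-, hz, -⟩
    · exact hadj.symm
    · have hz'' : z' = s ∨ z' = t := by tauto
      rcases hz with rfl | rfl <;> rcases hz'' with rfl | rfl <;>
        first | exact (hst hadj).elim | exact (hts hadj).elim | exact (hadj.ne rfl).elim
  rcases hb with hb | hb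
  · exact hab hb.symm
  · exact hb.1 rfl

theorem WalksMeet.adj_of_isCycle {K : SimpleGraph V} {s t : V} (h : WalksMeet K s t)
    (hst : ¬ K.Adj s t) {u : V} {c : K.Walk u u} (hc : c.IsCycle) {a b : V} (ha : a ∈ c.support)
    (hb : b ∈ c.support) (hab : a ≠ b) :
    K.Adj a b ∨ (K.Adj s a ∧ K.Adj s b) ∨ (K.Adj t a ∧ K.Adj t b) := by
  obtain ⟨p, q, hpq⟩ := exists_arcs hc ha hb
  refine adj_of_reachable_restrictTo hst hab (h hab p q _ (by simp) (by simp) fun z hz hz' => ?_)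
  rcases hpq z hz hz' with rfl | rfl <;> simp

/-- The walks from `s` to `x` through `a` and through `b`, continued along a fan in the cycle, meet
only in `s` and `x`. -/
theorem WalksMeet.adj_of_two_neighbors {K : SimpleGraph V} {s t : V} (h : WalksMeet K s t)
    (hst : ¬ K.Adj s t) {u : V} {c : K.Walk u u} (hc : c.IsCycle) {a b : V} (ha : a ∈ c.support)
    (hb : b ∈ c.support) (hab : a ≠ b) (hsa : K.Adj s a) (hsb : K.Adj s b) {x : V}
    (hx : x ∈ c.support) (hxs : x ≠ s) : K.Adj s x := by
  by_cases hax : a = x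
  · exact hax ▸ hsa
  obtain ⟨p, q, hpq⟩ := exists_fan hc ha hb hx hab hax
  -- `s` is repeated so that `adj_of_reachable_restrictTo` applies with `s` as first end; its last
  -- two alternatives then need a loop at `s` or the edge `s(s, t)`.
  have hr := h hxs.symm (.cons hsa p) (.cons hsb q) {s, x, s, t} (by simp) (by simp) (by
    intro z hz hz'
    rw [Walk.support_cons, List.mem_cons] at hz hz'
    rcases hz with rfl | hz
    · simp
    · rcases hz' with rfl | hz'
      · simp
      · simp [hpq z hz hz'])
  rcases adj_of_reachable_restrictTo hst hxs.symm hr with h | h | h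
  · exact h
  · exact (h.1.ne rfl).elim
  · exact (hst h.1.symm).elim

theorem UniqueMinEdge.atMostOneChordlessCycleThrough {G : SimpleGraph V} {w : Sym2 V → ℝ}
    {σ₁ σ₂ : ℝ} {s t : V} (h : UniqueMinEdge G w σ₁ σ₂ s t)
    (hmeet : WalksMeet (heavyGraph G s t) s t) :
    AtMostOneChordlessCycleThrough G s(s, t) := by
  have aux : ∀ (a b : V) (p : G.Walk a a) (q : G.Walk b b),
      p.IsCycle → p.IsChordless → s(s, t) ∈ p.edges → q.IsCycle → s(s, t) ∈ q.edges →
      ∀ x ∈ p.support, x ∈ q.support := by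
    intro a b p q hp hpc hpe hq hqe x hx
    obtain ⟨p', hp', hpn, hpedges, hpsupp⟩ := exists_path_of_mem_edges_isCycle hp hpe
    obtain ⟨q', -, hqn, -, hqsupp⟩ := exists_path_of_mem_edges_isCycle hq hqe
    have hpt : ∀ e ∈ p'.edges, e ∈ (heavyGraph G s t).edgeSet := fun e he =>
      mem_edgeSet_heavyGraph.mpr ⟨p'.edges_subset_edgeSet he, fun h => hpn (h ▸ he)⟩
    have hqt : ∀ e ∈ q'.edges, e ∈ (heavyGraph G s t).edgeSet := fun e he =>
      mem_edgeSet_heavyGraph.mpr ⟨q'.edges_subset_edgeSet he, fun h => hqn (h ▸ he)⟩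
    -- The common vertices of the two paths connect `t` to `s`. By chordlessness a walk on them uses
    -- only edges of `p'`, hence visits all of `p'`.
    have hr := hmeet h.adj.ne.symm (p'.transfer _ hpt) (q'.transfer _ hqt)
      (p'.support.toFinset ∩ q'.support.toFinset) (by simp) (by simp) (by simp +contextual)
    obtain ⟨r, hr⟩ := exists_walk_of_reachable_restrictTo (by simp) hr
    replace hr : ∀ z ∈ r.support, z ∈ p'.support ∧ z ∈ q'.support := fun z hz => by
      simpa using (hr z hz).1
    have hsub := support_subset_of_edges_subset (r := r) (hp'.transfer hpt) (by
      intro e he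
      rw [Walk.edges_transfer]
      induction e using Sym2.ind with
      | h y z =>
        have hadj := heavyGraph_adj.mp (r.adj_of_mem_edges he)
        have := hpc.mem_edges ((hpsupp y).mpr (hr y (r.fst_mem_support_of_mem_edges he)).1)
          ((hpsupp z).mpr (hr z (r.snd_mem_support_of_mem_edges he)).1) hadj.1
        exact ((hpedges _).mp this).resolve_left hadj.2)
    rw [Walk.support_transfer] at hsub
    exact (hqsupp x).mpr (hr x (hsub x ((hpsupp x).mp hx))).2
  intro a b p q hp hpc hpe hq hqc hqe
  exact toSubgraph_eq_of_isChordless hpc hqc fun x =>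
    ⟨aux a b p q hp hpc hpe hq hqe x, aux b a q p hq hqc hqe hp hpe x⟩

/-- Two nonadjacent vertices of the cycle have `s` or `t` as a common neighbour in `K`, and two
neighbours on the cycle propagate to all of it. -/
theorem UniqueMinEdge.isCompleteCycle_or_allLinkedTo {G : SimpleGraph V} {w : Sym2 V → ℝ}
    {σ₁ σ₂ : ℝ} {s t : V} (h : UniqueMinEdge G w σ₁ σ₂ s t)
    (hmeet : WalksMeet (heavyGraph G s t) s t) {u : V} (p : G.Walk u u) (hp : p.IsCycle)
    (hpw : ∀ e ∈ p.edges, w e = σ₂) :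
    IsCompleteCycle G p ∨ ∃ z ∈ s(s, t), AllLinkedTo G p z := by
  have hpt : ∀ e ∈ p.edges, e ∈ (heavyGraph G s t).edgeSet := fun e he =>
    mem_edgeSet_heavyGraph.mpr ⟨p.edges_subset_edgeSet he, fun h' => h.lt.ne (by
      rw [← h.weight_eq, ← h', hpw e he])⟩
  have hc : (p.transfer _ hpt).IsCycle := hp.transfer hpt
  have hsupp : (p.transfer _ hpt).support = p.support := p.support_transfer hpt
  have hst := not_heavyGraph_adj G s t
  have hts : ¬ (heavyGraph G s t).Adj t s := fun h => hst h.symm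
  generalize p.transfer _ hpt = c at hc hsupp
  by_cases hcomplete : IsCompleteCycle G p
  · exact Or.inl hcomplete
  right
  simp only [IsCompleteCycle, isClique_iff, Set.Pairwise, Set.mem_ofPred_eq] at hcomplete
  push Not at hcomplete
  obtain ⟨a, ha, b, hb, hab, hnadj⟩ := hcomplete
  rw [← hsupp] at ha hb
  rcases hmeet.adj_of_isCycle hst hc ha hb hab with h' | ⟨hsa, hsb⟩ | ⟨hta, htb⟩
  · exact (hnadj (heavyGraph_le G s t h')).elim
  · refine ⟨s, by simp, fun x hx hxs => ?_⟩
    exact heavyGraph_le G s t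
      (hmeet.adj_of_two_neighbors hst hc ha hb hab hsa hsb (hsupp ▸ hx) hxs)
  · refine ⟨t, by simp, fun x hx hxt => ?_⟩
    exact heavyGraph_le G s t
      (hmeet.symm.adj_of_two_neighbors hts hc ha hb hab hta htb (hsupp ▸ hx) hxt)

end Inheritance

/-! ### Sufficiency of the two conditions. -/

section Converse

open SimpleGraph

variable {V : Type*}

/-- A component adjacent to two vertices outside of it carries a path between them. -/
theorem exists_path_through_block {K : SimpleGraph V} {A F : Finset V} {i j : V}
    (hF : F ∈ blocks (restrictTo K A) A) (hi : Touches K i F) (hj : Touches K j F) (hiA : i ∉ A)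
    (hjA : j ∉ A) (hij : i ≠ j) :
    ∃ q : K.Walk i j, q.IsPath ∧ 1 < q.length ∧ (∀ z ∈ q.support, z = i ∨ z = j ∨ z ∈ F) ∧
      ∃ x ∈ F, ∃ y ∈ F, x ∈ q.support ∧ y ∈ q.support ∧ K.Adj i x ∧ K.Adj j y := by
  classical
  obtain ⟨x, hx, hix⟩ := hi
  obtain ⟨y, hy, hjy⟩ := hj
  have hblock := block_eq_of_mem_blocks hF hx
  have hxA := subset_of_mem_blocks hF hx
  obtain ⟨p, hp⟩ := exists_walk_of_reachable_restrictTo hxA (mem_block.mp (hblock ▸ hy)).2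
  have hpF : ∀ z ∈ p.bypass.support, z ∈ F := fun z hz => by
    rw [← hblock]
    exact mem_block.mpr (hp z (p.support_bypass_subset_support hz))
  have hiF : i ∉ F := fun h => hiA (subset_of_mem_blocks hF h)
  have hjF : j ∉ F := fun h => hjA (subset_of_mem_blocks hF h)
  refine ⟨.cons hix (p.bypass.concat hjy.symm), ?_, by simp, ?_, x, hx, y, hy, ?_, ?_, hix, hjy⟩
  · rw [Walk.cons_isPath_iff, Walk.concat_isPath_iff]
    refine ⟨⟨p.bypass_isPath, fun h => hjF (hpF j h)⟩, ?_⟩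
    rw [Walk.support_concat]
    simp only [List.mem_append, List.mem_singleton, not_or]
    exact ⟨fun h => hiF (hpF i h), hij⟩
  · intro z hz
    simp only [Walk.support_cons, Walk.support_concat, List.mem_cons,
      List.mem_append, List.not_mem_nil, or_false] at hz
    rcases hz with rfl | hz | rfl
    · simp
    · exact Or.inr (Or.inr (hpF z hz))
    · simp
  · simp [Walk.support_concat]
  · simp [Walk.support_concat]

/-- The triangle on three pairwise adjacent vertices is a chordless cycle. -/
theorem exists_triangle {G : SimpleGraph V} {s t i : V} (hst : G.Adj s t) (hsi : G.Adj s i)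
    (hti : G.Adj t i) : ∃ p : G.Walk s s, p.IsCycle ∧ p.IsChordless ∧ s(s, t) ∈ p.edges ∧
      ∀ x, x ∈ p.support ↔ x = s ∨ x = t ∨ x = i := by
  refine ⟨.cons hst (.cons hti (.cons hsi.symm .nil)), ?_, ?_, by simp, fun x => ?_⟩
  · have := hst.ne; have := hsi.ne; have := hti.ne
    rw [Walk.cons_isCycle_iff]
    simp only [Walk.cons_isPath_iff, Walk.edges_cons, Walk.support_cons, Walk.support_nil,
      Walk.edges_nil]
    simp_all [eq_comm]
  · rw [Walk.isChordless_iff_forall_mem_edges]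
    intro x y hx hy hadj
    have := hadj.ne
    simp only [Walk.support_cons, Walk.support_nil, List.mem_cons, List.not_mem_nil,
      or_false] at hx hy
    simp only [Walk.edges_cons, Walk.edges_nil, List.mem_cons, List.not_mem_nil, or_false]
    rcases hx with rfl | rfl | rfl | rfl <;> rcases hy with rfl | rfl | rfl | rfl <;>
      simp_all [Sym2.eq_swap]
  · simp only [Walk.support_cons, Walk.support_nil, List.mem_cons, List.not_mem_nil, or_false]
    tauto

variable {G : SimpleGraph V} {w : Sym2 V → ℝ} {σ₁ σ₂ : ℝ} {s t : V}

theorem eq_of_triangles (hst : G.Adj s t) (hone : AtMostOneChordlessCycleThrough G s(s, t))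
    {i j : V} (hsi : G.Adj s i) (hti : G.Adj t i) (hsj : G.Adj s j) (htj : G.Adj t j) :
    i = j := by
  obtain ⟨p, hp, hpc, hpe, hps⟩ := exists_triangle hst hsi hti
  obtain ⟨q, hq, hqc, hqe, hqs⟩ := exists_triangle hst hsj htj
  have h := hone s s p q hp hpc hpe hq hqc hqe
  have hi : i ∈ q.support := by
    rw [← Walk.mem_verts_toSubgraph, ← h, Walk.mem_verts_toSubgraph, hps]
    simp
  rcases (hqs i).mp hi with rfl | rfl | h
  · exact (hsi.ne rfl).elim
  · exact (hti.ne rfl).elim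
  · exact h

/-- The only edge at `z` that is lost in `heavyGraph` leads to `o`. -/
theorem mem_block_of_allLinked {A F : Finset V} {z o x : V}
    (hzo : s(z, o) = s(s, t)) (hz : z ∈ A) (hF : F ∈ blocks (restrictTo (heavyGraph G s t) A) A)
    (hx : x ∈ F) (hlink : x ≠ z → G.Adj z x) (hxo : x ≠ o) :
    block (restrictTo (heavyGraph G s t) A) A z = F := by
  refine block_eq_of_mem_blocks hF ?_
  by_cases hxz : x = z
  · exact hxz ▸ hx
  · rw [← block_eq_of_mem_blocks hF hx]
    refine mem_block.mpr ⟨hz, (Adj.reachable (G := restrictTo (heavyGraph G s t) A)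
      ⟨heavyGraph_adj.mpr ⟨hlink hxz, ?_⟩, hz, subset_of_mem_blocks hF hx⟩).symm⟩
    rw [← hzo]
    exact fun h => hxo (Sym2.congr_right.mp h)

theorem UniqueMinEdge.eq_of_touches (h : UniqueMinEdge G w σ₁ σ₂ s t)
    (hone : AtMostOneChordlessCycleThrough G s(s, t))
    (hcycle : ∀ (u : V) (p : G.Walk u u), p.IsCycle → (∀ e ∈ p.edges, w e = σ₂) →
      IsCompleteCycle G p ∨ ∃ z ∈ s(s, t), AllLinkedTo G p z)
    {A : Finset V} {i j : V} (hs : s ∈ A) (ht : t ∈ A) (hi : i ∉ A) (hj : j ∉ A) (hij : i ≠ j)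
    {F F' : Finset V} (hF : F ∈ blocks (restrictTo (heavyGraph G s t) A) A)
    (hF' : F' ∈ blocks (restrictTo (heavyGraph G s t) A) A)
    (hiF : Touches (heavyGraph G s t) i F) (hjF : Touches (heavyGraph G s t) j F)
    (hiF' : Touches (heavyGraph G s t) i F') (hjF' : Touches (heavyGraph G s t) j F') :
    F = F' := by
  by_contra hne
  have hdisj : ∀ z, z ∈ F → z ∉ F' := fun z hz => Finset.disjoint_left.mp
    (blocks_pairwiseDisjoint _ _ hF hF' hne) hz
  obtain ⟨q, hq, hlen, hqF, x, hx, y, hy, hxq, hyq, hix, hjy⟩ :=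
    exists_path_through_block hF hiF hjF hi hj hij
  obtain ⟨q', hq', -, hqF', x', hx', y', hy', hxq', hyq', hix', hjy'⟩ :=
    exists_path_through_block hF' hiF' hjF' hi hj hij
  have hc : (q.append q'.reverse).IsCycle := by
    -- `hlen` excludes a closed walk running back and forth along one edge.
    refine hq.isCycle_append hq'.reverse ?_ (Or.inl hlen)
    have hnd := hq.support_nodup
    have hnd' := hq'.reverse.support_nodup
    rw [← Walk.cons_tail_support, List.nodup_cons] at hnd hnd'
    intro z hz hz'
    have hzi : z ≠ i := by rintro rfl; exact hnd.1 hz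
    have hzj : z ≠ j := by rintro rfl; exact hnd'.1 hz'
    have h₁ := hqF z (List.mem_of_mem_tail hz)
    have h₂ := hqF' z (by simpa using List.mem_of_mem_tail hz')
    exact hdisj z ((h₁.resolve_left hzi).resolve_left hzj) ((h₂.resolve_left hzi).resolve_left hzj)
  have hmem : ∀ z, z ∈ q.support ∨ z ∈ q'.support → z ∈ (q.append q'.reverse).support := by
    simp [Walk.mem_support_append_iff]
  generalize q.append q'.reverse = c at hc hmem
  have hct : ∀ e ∈ c.edges, e ∈ G.edgeSet := fun e he =>
    (mem_edgeSet_heavyGraph.mp (c.edges_subset_edgeSet he)).1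
  have hout : ∀ {k z}, (heavyGraph G s t).Adj k z → G.Adj z k := fun h =>
    (heavyGraph_adj.mp h).1.symm
  have heavy : ∀ {z z'}, z ∈ F → z' ∈ F' → ¬ (heavyGraph G s t).Adj z z' := by
    intro z z' hz hz' hadj
    refine hdisj z' ?_ hz'
    rw [← block_eq_of_mem_blocks hF hz]
    have hzA' := subset_of_mem_blocks hF' hz'
    exact mem_block.mpr ⟨hzA', Adj.reachable (G := restrictTo (heavyGraph G s t) A)
      ⟨hadj, subset_of_mem_blocks hF hz, hzA'⟩⟩
  -- Both cases end here: `i` and `j` would span two triangles on `e₁`.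
  have hfinal : ∀ z o, s(z, o) = s(s, t) → G.Adj z i → G.Adj z j → G.Adj o i → G.Adj o j →
      False := by
    intro z o hzo hzi hzj hoi hoj
    rw [Sym2.eq_iff] at hzo
    rcases hzo with ⟨rfl, rfl⟩ | ⟨rfl, rfl⟩
    · exact hij (eq_of_triangles h.adj hone hzi hoi hzj hoj)
    · exact hij (eq_of_triangles h.adj hone hoi hzi hoj hzj)
  rcases hcycle i (c.transfer G hct) (hc.transfer hct) (by
    intro e he
    rw [Walk.edges_transfer] at he
    have := mem_edgeSet_heavyGraph.mp (c.edges_subset_edgeSet he)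
    exact h.weight_of_ne e this.1 this.2) with hcomp | ⟨z, hz, hlink⟩
  -- Distinct blocks are joined by no heavy edge, so in a complete cycle every pair across them is
  -- `e₁`; each block thus contributes a single vertex.
  · have key : ∀ z z', z ∈ F → z' ∈ F' → z ∈ q.support → z' ∈ q'.support →
        s(z, z') = s(s, t) := by
      intro z z' hz hz' hzq hzq'
      by_contra hcon
      refine heavy hz hz' (heavyGraph_adj.mpr ⟨hcomp ?_ ?_ ?_, hcon⟩)
      · simp [Walk.support_transfer, hmem, hzq]
      · simp [Walk.support_transfer, hmem, hzq']
      · rintro rfl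
        exact hdisj z hz hz'
    have h₁ := key x x' hx hx' hxq hxq'
    obtain rfl : x = y := Sym2.congr_left.mp (h₁.trans (key y x' hy hx' hyq hxq').symm)
    obtain rfl : x' = y' := Sym2.congr_right.mp (h₁.trans (key x y' hx hy' hxq hyq').symm)
    exact hfinal x x' h₁ (hout hix) (hout hjy) (hout hix') (hout hjy')
  · obtain ⟨o, hzo⟩ := hz
    have hlink' : ∀ x, x ∈ q.support ∨ x ∈ q'.support → x ≠ z → G.Adj z x := fun x hx =>
      hlink x (by rw [Walk.support_transfer]; exact hmem x hx)
    have hzA : z ∈ A := by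
      have : z ∈ s(s, t) := hzo ▸ Sym2.mem_mk_left z o
      rcases Sym2.mem_iff.mp this with rfl | rfl <;> assumption
    have hzi := hlink' i (Or.inl q.start_mem_support) (by rintro rfl; exact hi hzA)
    have hzj := hlink' j (Or.inl q.end_mem_support) (by rintro rfl; exact hj hzA)
    -- At least one of `F`, `F'` is not the block of `z`; linked to `z`, the cycle's vertices in it
    -- can only be the other end `o` of `e₁`.
    by_cases hzF : block (restrictTo (heavyGraph G s t) A) A z = F
    · have eq_o : ∀ y, y ∈ F' → y ∈ q'.support → y = o := by
        intro y hy hyq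
        by_contra hyo
        exact hne (hzF.symm.trans (mem_block_of_allLinked hzo.symm hzA hF' hy
          (hlink' y (Or.inr hyq)) hyo))
      exact hfinal z o hzo.symm hzi hzj (eq_o x' hx' hxq' ▸ hout hix')
        (eq_o y' hy' hyq' ▸ hout hjy')
    · have eq_o : ∀ y, y ∈ F → y ∈ q.support → y = o := by
        intro y hy hyq
        by_contra hyo
        exact hzF (mem_block_of_allLinked hzo.symm hzA hF hy (hlink' y (Or.inl hyq)) hyo)
      exact hfinal z o hzo.symm hzi hzj (eq_o x hx hxq ▸ hout hix)
        (eq_o y hy hyq ▸ hout hjy)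

theorem UniqueMinEdge.inheritsConvexity [DecidableEq V] (h : UniqueMinEdge G w σ₁ σ₂ s t)
    (hone : AtMostOneChordlessCycleThrough G s(s, t))
    (hcycle : ∀ (u : V) (p : G.Walk u u), p.IsCycle → (∀ e ∈ p.edges, w e = σ₂) →
      IsCompleteCycle G p ∨ ∃ z ∈ s(s, t), AllLinkedTo G p z) :
    InheritsConvexity G w := by
  intro v hz hv
  have nonneg : ∀ A, 0 ≤ restrictedGame G w v A := fun A =>
    Finset.sum_nonneg fun F _ => hv.nonneg hz F
  have mono : ∀ A i, i ∉ A → restrictedGame G w v A ≤ restrictedGame G w v (insert i A) := by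
    intro A i hi
    by_cases hA : s ∈ A ∧ t ∈ A
    · rw [h.restrictedGame_eq v hA.1 hA.2, h.restrictedGame_eq v (by simp [hA.1]) (by simp [hA.2])]
      exact componentWorth_le_insert _ hz hv hi
    · rw [h.restrictedGame_eq_zero hz hA]
      exact nonneg _
  refine isConvexGame_of_local fun A i j hi hj hij => ?_
  by_cases hA : s ∈ A ∧ t ∈ A
  · obtain ⟨hs, ht⟩ := hA
    rw [h.restrictedGame_eq v hs ht, h.restrictedGame_eq v (by simp [hs]) (by simp [ht]),
      h.restrictedGame_eq v (by simp [hs]) (by simp [ht]),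
      h.restrictedGame_eq v (by simp [hs]) (by simp [ht])]
    exact componentWorth_local _ hz hv hi hj hij fun F hF F' hF' h₁ h₂ h₃ h₄ =>
      h.eq_of_touches hone hcycle hs ht hi hj hij hF hF' h₁ h₂ h₃ h₄
  -- As `i ≠ j`, at most one of the two enlarged sets contains both ends of `e₁`, so monotonicity
  -- suffices.
  · rw [h.restrictedGame_eq_zero hz hA, add_zero]
    by_cases hAi : s ∈ insert i A ∧ t ∈ insert i A
    · have hAj : ¬ (s ∈ insert j A ∧ t ∈ insert j A) := by
        rintro ⟨hs, ht⟩
        simp only [Finset.mem_insert] at hs ht hAi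
        grind
      rw [h.restrictedGame_eq_zero hz hAj, add_zero]
      exact mono _ _ (by simp [hij.symm, hj])
    · rw [h.restrictedGame_eq_zero hz hAi, zero_add, Finset.insert_comm]
      exact mono _ _ (by simp [hij, hi])

end Converse

end PminGame

/-! ### The equivalence. -/

theorem mainTheorem2 {V : Type*} [Fintype V] [DecidableEq V]
    (G : SimpleGraph V) (hG : G.Connected) (w : Sym2 V → ℝ)
    (σ₁ σ₂ : ℝ) (hσ : σ₁ < σ₂) (hw : w '' G.edgeSet = {σ₁, σ₂})
    (e₁ : Sym2 V) (he₁ : {e | e ∈ G.edgeSet ∧ w e = σ₁} = {e₁}) :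
    PminGame.InheritsConvexity G w ↔
      PminGame.AtMostOneChordlessCycleThrough G e₁ ∧
      ∀ (u : V) (p : G.Walk u u), p.IsCycle → (∀ e ∈ p.edges, w e = σ₂) →
        PminGame.IsCompleteCycle G p ∨ ∃ z ∈ e₁, PminGame.AllLinkedTo G p z := by
  induction e₁ using Sym2.ind with
  | h s t =>
    have hst : s(s, t) ∈ {e | e ∈ G.edgeSet ∧ w e = σ₁} := he₁ ▸ rfl
    have h : PminGame.UniqueMinEdge G w σ₁ σ₂ s t := by
      refine ⟨hst.1, hσ, hst.2, fun e he hne => ?_⟩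
      have hwe : w e ∈ ({σ₁, σ₂} : Set ℝ) := hw ▸ Set.mem_image_of_mem w he
      refine hwe.resolve_left fun h₁ => hne ?_
      have : e ∈ {e | e ∈ G.edgeSet ∧ w e = σ₁} := ⟨he, h₁⟩
      rwa [he₁] at this
    refine ⟨fun hinh => ?_, fun hcond => h.inheritsConvexity hcond.1 hcond.2⟩
    have hmeet := h.walksMeet hinh
    exact ⟨h.atMostOneChordlessCycleThrough hmeet, fun u p =>
      h.isCompleteCycle_or_allLinkedTo hmeet p⟩
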